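/- For a partial order $P$ on $[n]=\{1,\dots,n\}$, let $\mathcal L(P)$ be the set of permutations $\pi$ of $[n]$ such that $\pi^{-1}(i)<\pi^{-1}(j)$ whenever $i<_P j$, let $\mathrm{des}(\pi)=|\{i\in[n-1]:\pi(i)>\pi(i+1)\}|$, and let $A_P(t)=\sum_{\pi\in\mathcal L(P)}t^{1+\mathrm{des}(\pi)}$ be the $P$-Eulerian polynomial. Let $Z_n$ be the zig-zag poset $1<_P2>_P3<_P4>_P\cdots$ on $[n]$, let $\varepsilon$ be the product of the adjacent transpositions $(i,i+1)$ of $[n]$ with $i$ even, and let $\varepsilon Z_n$ be the (naturally labeled) poset on $[n]$ obtained from $Z_n$ by replacing each label $i$ by $\varepsilon(i)$. The $n$th zig-zag Eulerian polynomial is $Z_n(t)=A_{\varepsilon Z_n}(t)$, and the zig-zag Eulerian number $z(n,k)$ is the coefficient of $t^{k+1}$ in $Z_n(t)$. Theorem. For each $n\ge 2$, the polynomial $Z_n(t)/t$ has a nonnegative expansion in the basis $\{t^j(1+t)^{n-2-2j}\}_{0\le 2j\le n-2}$; that is, there exist nonnegative integers $\gamma_{n,j}$ such that $$Z_n(t)=t\cdot\sum_{0\le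 2j\le n-2}\gamma_{n,j}\,t^j(1+t)^{n-2-2j}=\sum_{0\le 2j\le n-2}\gamma_{n,j}\,t^{j+1}(1+t)^{n-2(j+1)}.$$ In particular, $Z_n(t)$ has degree $n-1$; it is palindromic of palindromic degree $n$, i.e. $t^nZ_n(1/t)=Z_n(t)$; and the numbers $z(n,k)$, $0\le k\le n-2$, are symmetric, $z(n,k)=z(n,n-2-k)$, and unimodal, $$z(n,0)\le z(n,1)\le\cdots\le z(n,\lfloor (n-2)/2\rfloor)\ge\cdots\ge z(n,n-2).$$ -/

import Mathlib

open Polynomial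

namespace ZigZag

/-! Partial orders on the label set `[n]` are terms `P : PartialOrder (Fin n)`; the label `i` of
`[n] = {1, ..., n}` is the element `i - 1` of `Fin n`. A bare `<` or `≤` on `Fin n` is the order of the integers,
and `P.lt`, `P.le` is the order of `P`. -/

/-- The set `L(P)` of linear extensions of `P`: the permutations `π` of the label set, read as chains
`π(1) <_π π(2) <_π ... <_π π(n)`, such that `i <_P j` implies `π⁻¹(i) < π⁻¹(j)`. -/
noncomputable def linearExtensions {n : ℕ} (P : PartialOrder (Fin n)) :
    Finset (Equiv.Perm (Fin n)) :=
  open Classical in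
  Finset.univ.filter fun π => ∀ i j : Fin n, P.lt i j → π.symm i < π.symm j

/-- The descent set of a permutation: the positions `i` that have a successor position `i + 1` and
satisfy `π(i) > π(i + 1)`. -/
def descents {n : ℕ} (π : Equiv.Perm (Fin n)) : Finset (Fin n) :=
  Finset.univ.filter fun i => ∃ h : (i : ℕ) + 1 < n, π ⟨(i : ℕ) + 1, h⟩ < π i

/-- The number of descents. -/
def des {n : ℕ} (π : Equiv.Perm (Fin n)) : ℕ := (descents π).card

/-- The `P`-Eulerian polynomial `A_P(t) = ∑_{π ∈ L(P)} t^(1 + des π)`. -/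
noncomputable def eulerianPoly {n : ℕ} (P : PartialOrder (Fin n)) : ℤ[X] :=
  ∑ π ∈ linearExtensions P, X ^ (1 + des π)

/-- The zig-zag poset `1 < 2 > 3 < 4 > ...` on `[n]`. With labels shifted down by one, the even
elements are minimal, the odd ones are maximal, and comparable elements are adjacent integers. -/
@[reducible] def zigzag (n : ℕ) : PartialOrder (Fin n) where
  le i j := i = j ∨
    (Even (i : ℕ) ∧ Odd (j : ℕ) ∧ ((j : ℕ) = (i : ℕ) + 1 ∨ (i : ℕ) = (j : ℕ) + 1))
  lt i j := Even (i : ℕ) ∧ Odd (j : ℕ) ∧ ((j : ℕ) = (i : ℕ) + 1 ∨ (i : ℕ) = (j : ℕ) + 1)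
  lt_iff_le_not_ge i j := by
    constructor
    · rintro ⟨h1, h2, h3⟩
      refine ⟨Or.inr ⟨h1, h2, h3⟩, ?_⟩
      rintro (rfl | ⟨h4, _, _⟩)
      · exact absurd h1 (Nat.not_even_iff_odd.mpr h2)
      · exact absurd h4 (Nat.not_even_iff_odd.mpr h2)
    · rintro ⟨rfl | h, h'⟩
      · exact absurd (Or.inl rfl) h'
      · exact h
  le_refl i := Or.inl rfl
  le_trans i j k := by
    rintro (rfl | ⟨h1, h2, h3⟩) (rfl | ⟨h4, h5, h6⟩)
    · exact Or.inl rfl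
    · exact Or.inr ⟨h4, h5, h6⟩
    · exact Or.inr ⟨h1, h2, h3⟩
    · exact absurd h4 (Nat.not_even_iff_odd.mpr h2)
  le_antisymm i j := by
    rintro (rfl | ⟨h1, h2, h3⟩) (h | ⟨h4, h5, h6⟩)
    · rfl
    · rfl
    · exact h.symm
    · exact absurd h4 (Nat.not_even_iff_odd.mpr h2)

/-- The underlying map of `ε = s₂ s₄ s₆ ⋯`, the product of all the transpositions `s_i = (i, i+1)` with
`i` even and `i + 1 ≤ n`. With labels shifted down by one it exchanges `1 ↔ 2`, `3 ↔ 4`, and so on;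
`0` is fixed, and so is `n - 1` when `n` is even. -/
def epsFun (n : ℕ) (i : Fin n) : Fin n :=
  if Odd (i : ℕ) then
    if h : (i : ℕ) + 1 < n then ⟨(i : ℕ) + 1, h⟩ else i
  else ⟨(i : ℕ) - 1, lt_of_le_of_lt (Nat.sub_le _ _) i.isLt⟩

theorem epsFun_involutive (n : ℕ) : Function.Involutive (epsFun n) := by
  rintro ⟨i, hi⟩
  simp only [epsFun, Nat.odd_iff]
  split_ifs <;> simp_all [Fin.ext_iff] <;> omega

/-- The permutation `ε` of the label set. -/
def eps (n : ℕ) : Equiv.Perm (Fin n) := (epsFun_involutive n).toPerm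

/-- The action of permutations on labeled posets: `σ P` has the relations `σ(i) <_{σP} σ(j)` for
`i <_P j`. -/
@[reducible] def relabel {n : ℕ} (σ : Equiv.Perm (Fin n)) (P : PartialOrder (Fin n)) : PartialOrder (Fin n) :=
  @PartialOrder.lift (Fin n) (Fin n) P σ.symm σ.symm.injective

/-- The `n`th zig-zag Eulerian polynomial `Z_n(t)`, the Eulerian polynomial of the naturally labeled
zig-zag poset `ε Z_n`. -/
noncomputable def zigzagEulerian (n : ℕ) : ℤ[X] := eulerianPoly (relabel (eps n) (zigzag n))

/-- The zig-zag Eulerian number `z(n, k)`, the coefficient of `t^(k+1)` in `Z_n(t)`. -/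
noncomputable def zigzagNumber (n k : ℕ) : ℤ := (zigzagEulerian n).coeff (k + 1)

/-- `h` is palindromic of palindromic degree `d`: `d` is a positive integer and
`t^d h(1/t) = h(t)`, an identity of Laurent polynomials. -/
def IsPalindromicOfDegree (h : ℤ[X]) (d : ℕ) : Prop :=
  0 < d ∧
    LaurentPolynomial.T (d : ℤ) * LaurentPolynomial.invert (toLaurent h) = toLaurent h

end ZigZag

namespace ZigZag

/-! ### The Eulerian polynomial does not depend on the natural labeling -/

section Labeling

variable {n : ℕ}

/-! The polynomial $A_P$ is the same for all natural labelings (`labelSum_eq_of_isNatural`), so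
`eps` may be replaced by `bipartiteLabel`, in which every minimal element of the zig-zag (small) has
a smaller label than every maximal one (large).

Cut a linear extension into maximal runs of small and of large letters. It starts with a small run
and, since no element is isolated, ends with a large one, so the runs form m pairs. A run is an
antichain, hence a block B can be ordered arbitrarily and contributes an ordinary Eulerian
polynomial, gamma-positive with center (|B| - 1)/2 (`wordSum_mem_gammaCone`). Passing from small to
large is an ascent and from large to small a descent; the extra factor t acts as a descent after the
last run. For fixed blocks the sum is thus t^m times 2m Eulerian polynomials, of palindromic degree
2m + (n - 2m) = n. Summing over blocks gives gamma-positivity of degree n (`runSum_mem_gammaCone`).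

The j = 0 term vanishes because Z_n(0) = 0. Symmetry and unimodality hold for each basis polynomial,
and the degree follows from symmetry and the existence of an extension without descents. -/

theorem mem_linearExtensions {P : PartialOrder (Fin n)} {π : Equiv.Perm (Fin n)} :
    π ∈ linearExtensions P ↔ ∀ i j : Fin n, P.lt i j → (π.symm i : ℕ) < π.symm j := by
  simp only [linearExtensions, Finset.mem_filter, Finset.mem_univ, true_and, Fin.lt_def]

/-- The descent generating polynomial of the linear extensions of `P`, where the elements of `P` are
compared through the labeling `κ`. -/
noncomputable def labelSum (P : PartialOrder (Fin n)) (κ : Equiv.Perm (Fin n)) : ℤ[X] :=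
  ∑ π ∈ linearExtensions P, X ^ (1 + des (κ * π))

/-- Fixing the poset and varying the labeling lets two labelings be compared over one set of linear
extensions. -/
theorem eulerianPoly_relabel (P : PartialOrder (Fin n)) (κ : Equiv.Perm (Fin n)) :
    eulerianPoly (relabel κ P) = labelSum P κ := by
  symm
  refine Finset.sum_equiv (Equiv.mulLeft κ) (fun π => ?_) fun π _ => rfl
  rw [mem_linearExtensions, mem_linearExtensions]
  constructor
  · intro h i j hij
    exact h _ _ hij
  · intro h i j hij
    have := h (κ i) (κ j) (by
      change P.lt (κ.symm (κ i)) (κ.symm (κ j))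
      simpa using hij)
    change (π.symm (κ.symm (κ i)) : ℕ) < π.symm (κ.symm (κ j)) at this
    simpa using this

/-- A labeling is natural if it is order preserving. -/
def IsNatural (P : PartialOrder (Fin n)) (κ : Equiv.Perm (Fin n)) : Prop :=
  ∀ x y, P.lt x y → (κ x : ℕ) < κ y

/-- Exchanging two consecutive labels only affects the comparison of the two elements which carry
them. -/
theorem swap_label_lt_iff (κ : Equiv.Perm (Fin n)) {a b : Fin n} (hab : (κ b : ℕ) = κ a + 1)
    {x y : Fin n} (h1 : ¬(x = a ∧ y = b)) (h2 : ¬(x = b ∧ y = a)) :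
    ((κ * Equiv.swap a b) x : ℕ) < (κ * Equiv.swap a b) y ↔ (κ x : ℕ) < κ y := by
  have key : ∀ u v : Fin n, u = v ∨ (κ u : ℕ) ≠ κ v := fun u v =>
    or_iff_not_imp_left.2 fun huv h => huv (κ.injective (Fin.ext h))
  have hxa := key x a
  have hxb := key x b
  have hya := key y a
  have hyb := key y b
  simp only [Equiv.Perm.mul_apply, Equiv.swap_apply_def]
  grind

theorem IsNatural.mul_swap {P : PartialOrder (Fin n)} {κ : Equiv.Perm (Fin n)}
    (hκ : IsNatural P κ) {a b : Fin n} (hab : (κ b : ℕ) = κ a + 1) (h1 : ¬P.lt a b)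
    (h2 : ¬P.lt b a) : IsNatural P (κ * Equiv.swap a b) := by
  intro x y hxy
  rw [swap_label_lt_iff κ hab]
  · exact hκ x y hxy
  · rintro ⟨rfl, rfl⟩; exact h1 hxy
  · rintro ⟨rfl, rfl⟩; exact h2 hxy

/-- The elements `a` and `b` occupy adjacent positions of `π`. -/
def Adjacent (a b : Fin n) (π : Equiv.Perm (Fin n)) : Prop :=
  (π.symm a : ℕ) = π.symm b + 1 ∨ (π.symm b : ℕ) = π.symm a + 1

theorem swap_mul_symm_apply (a b : Fin n) (π : Equiv.Perm (Fin n)) (x : Fin n) :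
    (Equiv.swap a b * π).symm x = π.symm (Equiv.swap a b x) := by
  rw [Equiv.symm_apply_eq]; simp

theorem adjacent_swap_mul {a b : Fin n} {π : Equiv.Perm (Fin n)} :
    Adjacent a b (Equiv.swap a b * π) ↔ Adjacent a b π := by
  simp only [Adjacent, swap_mul_symm_apply, Equiv.swap_apply_left, Equiv.swap_apply_right]
  exact or_comm

/-- No element stands between `a` and `b`, so their order relative to any third element is
unchanged. -/
theorem swap_mul_mem_linearExtensions {P : PartialOrder (Fin n)} {a b : Fin n} (h1 : ¬P.lt a b)
    (h2 : ¬P.lt b a) {π : Equiv.Perm (Fin n)} (hπ : π ∈ linearExtensions P)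
    (had : Adjacent a b π) : Equiv.swap a b * π ∈ linearExtensions P := by
  rw [mem_linearExtensions] at hπ ⊢
  intro x y hxy
  have h := hπ x y hxy
  have key : ∀ u v : Fin n, u = v ∨ (π.symm u : ℕ) ≠ π.symm v := fun u v =>
    or_iff_not_imp_left.2 fun huv h => huv (π.symm.injective (Fin.ext h))
  have hxa := key x a
  have hxb := key x b
  have hya := key y a
  have hyb := key y b
  have h3 : ¬(x = a ∧ y = b) := by rintro ⟨rfl, rfl⟩; exact h1 hxy
  have h4 : ¬(x = b ∧ y = a) := by rintro ⟨rfl, rfl⟩; exact h2 hxy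
  simp only [swap_mul_symm_apply, Equiv.swap_apply_def, Adjacent] at *
  clear hπ hxy h1 h2 P
  grind

theorem des_mul_swap {κ π : Equiv.Perm (Fin n)} {a b : Fin n} (hab : (κ b : ℕ) = κ a + 1)
    (had : ¬Adjacent a b π) : des (κ * Equiv.swap a b * π) = des (κ * π) := by
  unfold des descents
  congr 1
  refine Finset.filter_congr fun i _ => exists_congr fun h => ?_
  rw [Equiv.Perm.mul_apply _ π, Equiv.Perm.mul_apply _ π, Fin.lt_def, swap_label_lt_iff κ hab]
  · simp
  · rintro ⟨rfl, rfl⟩; exact had (by simp [Adjacent])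
  · rintro ⟨rfl, rfl⟩; exact had (by simp [Adjacent])

/-- The involution exchanges `a` and `b` where they are adjacent and fixes the other extensions. In
the first case the label words agree; in the second `a` and `b` are never compared, so the descents
agree. -/
theorem labelSum_mul_swap (P : PartialOrder (Fin n)) (κ : Equiv.Perm (Fin n)) {a b : Fin n}
    (hab : (κ b : ℕ) = κ a + 1) (h1 : ¬P.lt a b) (h2 : ¬P.lt b a) :
    labelSum P (κ * Equiv.swap a b) = labelSum P κ := by
  classical
  refine Finset.sum_nbij' (fun π => if Adjacent a b π then Equiv.swap a b * π else π)
    (fun π => if Adjacent a b π then Equiv.swap a b * π else π) ?_ ?_ ?_ ?_ ?_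
  · intro π hπ
    split_ifs with had
    exacts [swap_mul_mem_linearExtensions h1 h2 hπ had, hπ]
  · intro π hπ
    split_ifs with had
    exacts [swap_mul_mem_linearExtensions h1 h2 hπ had, hπ]
  · intro π _
    by_cases had : Adjacent a b π <;> simp [had, adjacent_swap_mul, ← mul_assoc]
  · intro π _
    by_cases had : Adjacent a b π <;> simp [had, adjacent_swap_mul, ← mul_assoc]
  · intro π _
    split_ifs with had
    · rw [mul_assoc]
    · rw [des_mul_swap hab had]

/-- The pairs which are ordered differently by two labelings. -/
def inversions (κ κ' : Equiv.Perm (Fin n)) : Finset (Fin n × Fin n) :=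
  Finset.univ.filter fun p => (κ' p.1 : ℕ) < κ' p.2 ∧ (κ p.2 : ℕ) < κ p.1

theorem mem_inversions {κ κ' : Equiv.Perm (Fin n)} {p : Fin n × Fin n} :
    p ∈ inversions κ κ' ↔ (κ' p.1 : ℕ) < κ' p.2 ∧ (κ p.2 : ℕ) < κ p.1 := by
  simp [inversions]

/-- Otherwise `κ' ∘ κ⁻¹` is a strictly increasing bijection of `Fin n`, hence the identity. -/
theorem exists_consecutive_inversion {κ κ' : Equiv.Perm (Fin n)} (h : κ ≠ κ') :
    ∃ a b, (κ b : ℕ) = κ a + 1 ∧ (κ' b : ℕ) < κ' a := by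
  by_contra! hcon
  apply h
  have hmono : StrictMono (fun i => κ' (κ.symm i)) := by
    cases n with
    | zero => exact fun i => i.elim0
    | succ m =>
      rw [Fin.strictMono_iff_lt_succ]
      intro i
      refine lt_of_le_of_ne (hcon _ _ (by simp)) fun he => ?_
      have := κ.symm.injective (κ'.injective he)
      exact absurd this (Fin.castSucc_lt_succ (i := i)).ne
  have hid := (StrictMono.range_inj hmono strictMono_id).1 (by
    rw [Set.range_id, Set.range_eq_univ]
    exact κ'.surjective.comp κ.symm.surjective)
  ext x
  have := congrFun hid (κ x)
  simp only [Equiv.symm_apply_apply, id] at this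
  rw [this]

/-- Bubble sort: two elements ordered differently by two natural labelings are incomparable, so a
consecutive inversion can be exchanged without leaving the natural labelings. -/
theorem labelSum_eq_of_isNatural (P : PartialOrder (Fin n)) {κ κ' : Equiv.Perm (Fin n)}
    (hκ : IsNatural P κ) (hκ' : IsNatural P κ') : labelSum P κ = labelSum P κ' := by
  induction hN : (inversions κ κ').card using Nat.strong_induction_on generalizing κ with
  | _ N ih =>
    by_cases heq : κ = κ'
    · rw [heq]
    obtain ⟨a, b, hab, hlt⟩ := exists_consecutive_inversion heq
    have h1 : ¬P.lt a b := fun h => by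
      have := hκ' a b h
      omega
    have h2 : ¬P.lt b a := fun h => by
      have := hκ b a h
      omega
    rw [← labelSum_mul_swap P κ hab h1 h2]
    refine ih _ ?_ (hκ.mul_swap hab h1 h2) rfl
    rw [← hN]
    -- The pair `(b, a)` stops being an inversion, and no new one appears.
    apply Finset.card_lt_card
    rw [Finset.ssubset_iff_of_subset]
    · refine ⟨(b, a), ?_, ?_⟩
      · rw [mem_inversions]
        dsimp only
        omega
      · rw [mem_inversions]
        simp only [Equiv.Perm.mul_apply, Equiv.swap_apply_left, Equiv.swap_apply_right]
        omega
    · rintro ⟨x, y⟩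
      rw [mem_inversions, mem_inversions]
      rintro ⟨h3, h4⟩
      refine ⟨h3, ?_⟩
      by_cases h5 : y = a ∧ x = b
      · obtain ⟨rfl, rfl⟩ := h5
        dsimp only
        omega
      · rwa [swap_label_lt_iff κ hab h5] at h4
        rintro ⟨rfl, rfl⟩
        dsimp only at h3
        omega

end Labeling

/-! ### Polynomials with nonnegative gamma vector -/

section Gamma

/-- The polynomials of center of symmetry `d / 2` with nonnegative gamma vector. -/
noncomputable def gammaCone (d : ℕ) : AddSubmonoid ℤ[X] :=
  AddSubmonoid.closure {f | ∃ j k : ℕ, 2 * j + k = d ∧ f = X ^ j * (1 + X) ^ k}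

theorem basis_mem_gammaCone {j k d : ℕ} (h : 2 * j + k = d) :
    (X ^ j * (1 + X) ^ k : ℤ[X]) ∈ gammaCone d :=
  AddSubmonoid.subset_closure ⟨j, k, h, rfl⟩

theorem one_mem_gammaCone : (1 : ℤ[X]) ∈ gammaCone 0 := by
  simpa using basis_mem_gammaCone (j := 0) (k := 0) rfl

theorem X_mem_gammaCone : (X : ℤ[X]) ∈ gammaCone 2 := by
  simpa using basis_mem_gammaCone (j := 1) (k := 0) rfl

theorem one_add_X_mem_gammaCone : (1 + X : ℤ[X]) ∈ gammaCone 1 := by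
  simpa using basis_mem_gammaCone (j := 0) (k := 1) rfl

theorem mul_mem_gammaCone {d e m : ℕ} {f g : ℤ[X]} (hf : f ∈ gammaCone d) (hg : g ∈ gammaCone e)
    (hm : d + e = m) : f * g ∈ gammaCone m := by
  induction hf using AddSubmonoid.closure_induction with
  | zero => simp
  | add x y _ _ hx hy => rw [add_mul]; exact add_mem hx hy
  | mem x hx =>
    obtain ⟨j, k, h, rfl⟩ := hx
    induction hg using AddSubmonoid.closure_induction with
    | zero => simp
    | add x y _ _ hx hy => rw [mul_add]; exact add_mem hx hy
    | mem y hy =>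
      obtain ⟨j', k', h', rfl⟩ := hy
      have := basis_mem_gammaCone (j := j + j') (k := k + k') (d := m) (by omega)
      convert this using 1
      ring

theorem exists_gamma_vector {d : ℕ} {f : ℤ[X]} (hf : f ∈ gammaCone d) :
    ∃ γ : ℕ → ℕ, f = ∑ j ∈ Finset.range (d / 2 + 1),
      (γ j : ℤ[X]) * (X ^ j * (1 + X) ^ (d - 2 * j)) := by
  induction hf using AddSubmonoid.closure_induction with
  | zero => exact ⟨0, by simp⟩
  | add x y _ _ hx hy =>
    obtain ⟨γ, rfl⟩ := hx
    obtain ⟨δ, rfl⟩ := hy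
    refine ⟨γ + δ, ?_⟩
    rw [← Finset.sum_add_distrib]
    refine Finset.sum_congr rfl fun j _ => ?_
    simp only [Pi.add_apply, Nat.cast_add]
    ring
  | mem x hx =>
    obtain ⟨j, k, h, rfl⟩ := hx
    refine ⟨fun i => if i = j then 1 else 0, ?_⟩
    rw [Finset.sum_eq_single j]
    · simp [show d - 2 * j = k by omega]
    · intro b _ hb; simp [hb]
    · intro hj
      exact absurd (Finset.mem_range.2 (by omega)) hj

end Gamma

/-! ### Words -/

section Words

variable {α : Type*}

/-- The number of descents of a word, its letters being compared through `κ`. -/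
def wordDes (κ : α → ℕ) : List α → ℕ
  | [] => 0
  | [_] => 0
  | a :: b :: l => (if κ b < κ a then 1 else 0) + wordDes κ (b :: l)

theorem wordDes_append (κ : α → ℕ) {u v : List α} {d : ℕ} (hu : u ≠ []) (hv : v ≠ [])
    (h : ∀ a ∈ u.getLast?, ∀ b ∈ v.head?, (if κ b < κ a then 1 else 0) = d) :
    wordDes κ (u ++ v) = wordDes κ u + d + wordDes κ v := by
  induction u with
  | nil => exact absurd rfl hu
  | cons a u ih =>
    cases u with
    | nil =>
      cases v with
      | nil => exact absurd rfl hv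
      | cons b v => simp [wordDes, h a (by simp) b (by simp)]
    | cons b u =>
      have ih := ih (by simp) fun a' ha' => h a' (by rwa [List.getLast?_cons_cons])
      simp only [List.cons_append, wordDes] at ih ⊢
      rw [ih]
      ring

/-- Whether the first letter of a word is large; the empty word counts as small. -/
def wordType (large : α → Bool) (w : List α) : Bool := w.head?.elim false large

/-- The words which are compatible with the relation `R`, start with a letter of type `b` and do
not end with a small letter. -/
structure Admissible (large : α → Bool) (R : α → α → Prop) (b : Bool) (w : List α) : Prop where
  pairwise : w.Pairwise fun x y => ¬R y x
  head : wordType large w = b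
  last : ∀ x ∈ w.getLast?, large x = true

variable {κ : α → ℕ} {large : α → Bool} {R : α → α → Prop}

/-- Inside a run `R` imposes nothing, as it only relates letters of different types. As the empty
word is small, `hv` allows an empty `v` only after a large run, which is the condition on the last
letter. -/
theorem admissible_append_iff (hR : ∀ x y, R x y → large x ≠ large y) {b : Bool} {u v : List α}
    (hu : u ≠ []) (hub : ∀ x ∈ u, large x = b) (hv : wordType large v = !b) :
    Admissible large R b (u ++ v) ↔
      (∀ x ∈ u, ∀ y ∈ v, ¬R y x) ∧ Admissible large R (!b) v := by
  have hup : u.Pairwise fun x y => ¬R y x :=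
    List.pairwise_of_forall_mem_list fun x hx y hy h => hR y x h (by rw [hub x hx, hub y hy])
  have hhead : wordType large (u ++ v) = b := by
    cases u with
    | nil => exact absurd rfl hu
    | cons a u => exact hub a (by simp)
  constructor
  · rintro ⟨h1, -, h3⟩
    rw [List.pairwise_append] at h1
    refine ⟨h1.2.2, h1.2.1, hv, fun x hx => h3 x ?_⟩
    rw [List.getLast?_append, Option.mem_def.1 hx]
    rfl
  · rintro ⟨h1, h2, -, h3⟩
    refine ⟨List.pairwise_append.2 ⟨hup, h2, h1⟩, hhead, fun x hx => ?_⟩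
    cases v with
    | nil =>
      have hb : b = true := by simpa [wordType] using hv
      rw [List.append_nil] at hx
      rw [hub x (List.mem_of_getLast? hx), hb]
    | cons c v =>
      rw [List.getLast?_append_of_ne_nil _ (by simp)] at hx
      exact h3 x hx

theorem takeWhile_eq_nil_of_wordType {b : Bool} {v : List α} (hv : wordType large v = !b) :
    v.takeWhile (fun x => large x == b) = [] := by
  cases v with
  | nil => rfl
  | cons a v =>
    have : large a = !b := hv
    simp [this]

theorem takeWhile_append_eq_left {b : Bool} {u v : List α} (hub : ∀ x ∈ u, large x = b)
    (hv : wordType large v = !b) : (u ++ v).takeWhile (fun x => large x == b) = u := by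
  rw [List.takeWhile_append_of_pos (by simpa using hub), takeWhile_eq_nil_of_wordType hv,
    List.append_nil]

theorem Admissible.exists_append {b : Bool} {w : List α} (h : Admissible large R b w)
    (hw : w ≠ []) : ∃ u v, u ++ v = w ∧ u ≠ [] ∧ (∀ x ∈ u, large x = b) ∧
      wordType large v = !b := by
  refine ⟨w.takeWhile (fun x => large x == b), w.dropWhile (fun x => large x == b),
    List.takeWhile_append_dropWhile, ?_, fun x hx => by simpa using List.mem_takeWhile_imp hx, ?_⟩
  · cases w with
    | nil => exact absurd rfl hw
    | cons a w =>
      have : large a = b := h.head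
      simp [this]
  · rcases hv : w.dropWhile (fun x => large x == b) with _ | ⟨a, v⟩
    · rw [List.dropWhile_eq_nil_iff] at hv
      have h1 := h.last _ (List.getLast?_eq_some_getLast hw)
      have h2 := hv _ (List.getLast_mem hw)
      rw [h1] at h2
      have : b = true := by simpa using h2.symm
      simp [this, wordType]
    · have := List.head_dropWhile_not (l := w) (fun x => large x == b) (by simp [hv])
      simp only [hv, List.head_cons] at this
      cases b <;> simp_all [wordType]

/-- With the end of a nonempty word counted as a descent, a large run is always followed by a
descent and a small run by an ascent. -/
theorem wordDes_run_append (hκ : ∀ x y, large x = false → large y = true → κ x < κ y) {b : Bool}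
    {u v : List α} (hu : u ≠ []) (hub : ∀ x ∈ u, large x = b) (hv : wordType large v = !b) :
    wordDes κ (u ++ v) + 1 =
      wordDes κ u + b.toNat + (wordDes κ v + if v = [] then 0 else 1) := by
  cases v with
  | nil =>
    have hb : b = true := by simpa [wordType] using hv
    simp [hb, wordDes]
  | cons c v =>
    have hc : large c = !b := hv
    rw [wordDes_append κ (d := b.toNat) hu (by simp), if_neg (by simp)]
    · ring
    · intro x hx y hy
      obtain rfl : c = y := by simpa using hy
      have hx := hub x (List.mem_of_getLast? hx)
      cases b
      · simp [(hκ x c hx hc).le]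
      · simp [hκ c x hc hx]

/-! ### Words on a finite alphabet and gamma-positivity of Eulerian polynomials -/

variable [DecidableEq α]

/-- The words which contain each letter of `U` once, and no other letter. -/
noncomputable def words (U : Finset α) : Finset (List α) := U.toList.permutations.toFinset

theorem mem_words {U : Finset α} {w : List α} : w ∈ words U ↔ w.Nodup ∧ w.toFinset = U := by
  rw [words, List.mem_toFinset, List.mem_permutations]
  constructor
  · intro h
    exact ⟨h.nodup_iff.2 U.nodup_toList, by rw [List.toFinset_eq_of_perm _ _ h, U.toList_toFinset]⟩
  · rintro ⟨h, rfl⟩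
    exact List.perm_of_nodup_nodup_toFinset_eq h (Finset.nodup_toList _) (by simp)

theorem mem_iff_of_mem_words {U : Finset α} {w : List α} (h : w ∈ words U) {x : α} :
    x ∈ w ↔ x ∈ U := by
  rw [← (mem_words.1 h).2, List.mem_toFinset]

theorem words_empty : words (∅ : Finset α) = {[]} := by
  ext w
  rw [mem_words, List.toFinset_eq_empty_iff, Finset.mem_singleton]
  exact ⟨fun h => h.2, by rintro rfl; simp⟩

theorem eq_nil_iff_of_mem_words {U : Finset α} {w : List α} (h : w ∈ words U) :
    w = [] ↔ U = ∅ := by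
  rw [← (mem_words.1 h).2, List.toFinset_eq_empty_iff]

theorem append_mem_words {U B : Finset α} (hB : B ⊆ U) {u v : List α} (hu : u ∈ words B)
    (hv : v ∈ words (U \ B)) : u ++ v ∈ words U := by
  rw [mem_words] at *
  refine ⟨List.nodup_append'.2 ⟨hu.1, hv.1, ?_⟩, ?_⟩
  · rw [← List.disjoint_toFinset_iff_disjoint, hu.2, hv.2]
    exact Finset.disjoint_sdiff
  · rw [List.toFinset_append, hu.2, hv.2, Finset.union_sdiff_of_subset hB]

theorem append_cons_mem_words {U B : Finset α} (hB : B ⊆ U) {x : α} (hx : x ∉ U) {u v : List α}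
    (hu : u ∈ words B) (hv : v ∈ words (U \ B)) : u ++ x :: v ∈ words (insert x U) := by
  have h := mem_words.1 (append_mem_words hB hu hv)
  rw [mem_words, List.nodup_middle, List.nodup_cons]
  refine ⟨⟨?_, h.1⟩, ?_⟩
  · rwa [← List.mem_toFinset, h.2]
  · rw [← h.2]; ext y; simp

/-- Cut each word at its only occurrence of `x`; `B` is the set of letters before it. -/
theorem sum_words_insert {M : Type*} [AddCommMonoid M] {U : Finset α} {x : α} (hx : x ∉ U)
    (G : List α → M) : ∑ w ∈ words (insert x U), G w =
      ∑ B ∈ U.powerset, ∑ u ∈ words B, ∑ v ∈ words (U \ B), G (u ++ x :: v) := by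
  rw [Finset.sum_sigma', Finset.sum_sigma']
  symm
  refine Finset.sum_bij (fun p _ => p.1.2 ++ x :: p.2) ?_ ?_ ?_ fun _ _ => rfl
  · rintro ⟨⟨B, u⟩, v⟩ h
    simp only [Finset.mem_sigma, Finset.mem_powerset] at h
    exact append_cons_mem_words h.1.1 hx h.1.2 h.2
  · rintro ⟨⟨B, u⟩, v⟩ h ⟨⟨B', u'⟩, v'⟩ h' he
    simp only [Finset.mem_sigma, Finset.mem_powerset] at h h' he
    have hxu : x ∉ u := fun hu => hx (h.1.1 ((mem_iff_of_mem_words h.1.2).1 hu))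
    have hxv : x ∉ v := fun hv => hx (Finset.mem_sdiff.1 ((mem_iff_of_mem_words h.2).1 hv)).1
    obtain ⟨rfl, -, rfl⟩ := (List.append_cons_inj_of_notMem hxu hxv).1 he
    have hB : B = B' := by rw [← (mem_words.1 h.1.2).2, (mem_words.1 h'.1.2).2]
    subst hB
    rfl
  · intro w hw
    obtain ⟨u, v, rfl⟩ := List.append_of_mem ((mem_iff_of_mem_words hw).2 (Finset.mem_insert_self x U))
    rw [mem_words, List.nodup_middle, List.nodup_cons] at hw
    obtain ⟨⟨h1, h2⟩, h3⟩ := hw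
    have h4 : (u ++ v).toFinset = U := by
      rw [← Finset.erase_insert hx, ← h3]
      ext y
      have : y ∈ u ++ v → y ≠ x := fun h e => h1 (e ▸ h)
      simp at this ⊢
      tauto
    rw [List.nodup_append'] at h2
    refine ⟨⟨⟨u.toFinset, u⟩, v⟩, ?_, rfl⟩
    simp only [Finset.mem_sigma, Finset.mem_powerset, mem_words]
    refine ⟨⟨?_, h2.1, trivial⟩, h2.2.1, ?_⟩
    · rw [← h4]; simp
    · rw [← h4, List.toFinset_append, Finset.union_sdiff_left, eq_comm, Finset.sdiff_eq_self_iff_disjoint]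
      rw [List.disjoint_toFinset_iff_disjoint]
      exact h2.2.2.symm

/-- The Eulerian polynomial of the letters `U`. -/
noncomputable def wordSum (κ : α → ℕ) (U : Finset α) : ℤ[X] := ∑ w ∈ words U, X ^ wordDes κ w

theorem wordSum_empty (κ : α → ℕ) : wordSum κ (∅ : Finset α) = 1 := by
  simp [wordSum, words_empty, wordDes]

/-- The maximal letter `x` is entered by an ascent and left by a descent, unless it comes last,
which means `B = U`. -/
theorem wordSum_insert (κ : α → ℕ) {U : Finset α} {x : α} (hx : ∀ y ∈ U, κ y < κ x) :
    wordSum κ (insert x U) = ∑ B ∈ U.powerset,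
      wordSum κ B * ((if B = U then 1 else X) * wordSum κ (U \ B)) := by
  rw [wordSum, sum_words_insert fun h => (hx x h).false]
  refine Finset.sum_congr rfl fun B hB => ?_
  rw [Finset.mem_powerset] at hB
  simp only [wordSum]
  rw [Finset.mul_sum, Finset.sum_mul_sum]
  refine Finset.sum_congr rfl fun u hu => Finset.sum_congr rfl fun v hv => ?_
  have hv' : v = [] ↔ B = U := by
    rw [eq_nil_iff_of_mem_words hv, Finset.sdiff_eq_empty_iff_subset]
    exact ⟨fun h => hB.antisymm h, fun h => h ▸ le_rfl⟩
  have h1 : wordDes κ (u ++ x :: v) = wordDes κ u + wordDes κ (x :: v) := by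
    by_cases hun : u = []
    · simp [hun, wordDes]
    · refine wordDes_append κ (d := 0) hun (by simp) fun a ha b hb => ?_
      obtain rfl : x = b := by simpa using hb
      have := hx a (hB ((mem_iff_of_mem_words hu).1 (List.mem_of_getLast? ha)))
      simp [this.not_gt]
  by_cases hvn : v = []
  · rw [if_pos (hv'.1 hvn), h1, hvn]
    simp [wordDes]
  · have h2 : wordDes κ ([x] ++ v) = 0 + 1 + wordDes κ v := by
      refine wordDes_append κ (by simp) hvn fun a ha b hb => ?_
      obtain rfl : x = a := by simpa using ha
      exact if_pos (hx b (Finset.mem_sdiff.1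
        ((mem_iff_of_mem_words hv).1 (List.mem_of_mem_head? hb))).1)
    rw [if_neg (mt hv'.2 hvn), h1, ← List.singleton_append, h2]
    ring

/-- Induction on the recursion at the maximal letter. With `V` the other letters, the terms `B = ∅`
and `B = V` combine into `1 + X` times the polynomial of `V`; every other term has degree (|B| - 1)
+ 2 + (|V \ B| - 1) = |V|. -/
theorem wordSum_mem_gammaCone {κ : α → ℕ} (hκ : Function.Injective κ) {U : Finset α}
    (hU : U.Nonempty) : wordSum κ U ∈ gammaCone (U.card - 1) := by
  induction hN : U.card using Nat.strong_induction_on generalizing U with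
  | _ N ih =>
    obtain ⟨x, hxU, hx⟩ := U.exists_max_image κ hU
    obtain ⟨V, hxV, rfl⟩ : ∃ V, x ∉ V ∧ insert x V = U :=
      ⟨U.erase x, Finset.notMem_erase x U, Finset.insert_erase hxU⟩
    have hlt : ∀ y ∈ V, κ y < κ x := fun y hy =>
      lt_of_le_of_ne (hx y (Finset.mem_insert_of_mem hy)) fun h => hxV (hκ h ▸ hy)
    rw [Finset.card_insert_of_notMem hxV] at hN
    rw [wordSum_insert κ hlt]
    rcases V.eq_empty_or_nonempty with rfl | hV
    · simp only [Finset.card_empty, zero_add] at hN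
      subst hN
      simpa [wordSum_empty] using one_mem_gammaCone
    have hpos := hV.card_pos
    have hVm := ih V.card (by omega) hV rfl
    have hVs : V ∈ V.powerset.erase ∅ :=
      Finset.mem_erase.2 ⟨hV.ne_empty, Finset.mem_powerset_self V⟩
    rw [← Finset.add_sum_erase _ _ (Finset.empty_mem_powerset V),
      ← Finset.add_sum_erase _ _ hVs, ← add_assoc]
    refine add_mem ?_ (sum_mem fun B hB => ?_)
    · rw [if_neg hV.ne_empty.symm, if_pos rfl]
      have := mul_mem_gammaCone one_add_X_mem_gammaCone hVm (m := N - 1) (by omega)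
      convert this using 1
      simp only [wordSum_empty, Finset.sdiff_empty, sdiff_self, Finset.bot_eq_empty]
      ring
    · simp only [Finset.mem_erase, Finset.mem_powerset] at hB
      obtain ⟨h1, h2, h3⟩ := hB
      have hBn : B.Nonempty := Finset.nonempty_iff_ne_empty.2 h2
      have hCn : (V \ B).Nonempty := Finset.sdiff_nonempty.2 fun h => h1 (h3.antisymm h)
      have hc := Finset.card_sdiff_add_card_eq_card h3
      have hB0 := hBn.card_pos
      have hC0 := hCn.card_pos
      rw [if_neg h1]
      exact mul_mem_gammaCone (ih B.card (by omega) hBn rfl)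
        (mul_mem_gammaCone X_mem_gammaCone (ih (V \ B).card (by omega) hCn rfl) rfl) (by omega)

/-! ### Decomposition of words into runs of small and large letters -/

open Classical in
/-- The generating polynomial of the admissible words, where the end of a nonempty word counts as
a descent. -/
noncomputable def runSum (κ : α → ℕ) (large : α → Bool) (R : α → α → Prop) (b : Bool)
    (U : Finset α) : ℤ[X] :=
  ∑ w ∈ words U with Admissible large R b w, X ^ (wordDes κ w + if w = [] then 0 else 1)

open Classical in
-- Split off the first maximal run, with letter set `B`. Its letters may come in any order, whence
-- the full Eulerian polynomial of `B`.
theorem runSum_eq_sum (hκ : ∀ x y, large x = false → large y = true → κ x < κ y)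
    (hR : ∀ x y, R x y → large x ≠ large y) (b : Bool) {U : Finset α} (hU : U.Nonempty) :
    runSum κ large R b U =
      ∑ B ∈ U.powerset with
          B.Nonempty ∧ (∀ x ∈ B, large x = b) ∧ ∀ x ∈ B, ∀ y ∈ U \ B, ¬R y x,
        wordSum κ B * (X ^ b.toNat * runSum κ large R (!b) (U \ B)) := by
  have hterm : ∀ B : Finset α, wordSum κ B * (X ^ b.toNat * runSum κ large R (!b) (U \ B)) =
      ∑ u ∈ words B, ∑ v ∈ words (U \ B) with Admissible large R (!b) v,
        X ^ (wordDes κ u + b.toNat + (wordDes κ v + if v = [] then 0 else 1)) := by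
    intro B
    rw [wordSum, runSum, Finset.mul_sum, Finset.sum_mul_sum]
    refine Finset.sum_congr rfl fun u _ => Finset.sum_congr rfl fun v _ => ?_
    ring
  simp only [hterm]
  rw [Finset.sum_sigma', Finset.sum_sigma', runSum]
  symm
  refine Finset.sum_bij (fun p _ => p.1.2 ++ p.2) ?_ ?_ ?_ ?_
  · rintro ⟨⟨B, u⟩, v⟩ h
    simp only [Finset.mem_sigma, Finset.mem_filter, Finset.mem_powerset] at h ⊢
    obtain ⟨⟨⟨hB, hBn, hBb, hBR⟩, hu⟩, hv, hva⟩ := h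
    refine ⟨append_mem_words hB hu hv, (admissible_append_iff hR
      (mt (eq_nil_iff_of_mem_words hu).1 hBn.ne_empty)
      (fun x hx => hBb x ((mem_iff_of_mem_words hu).1 hx)) hva.head).2 ⟨fun x hx y hy =>
        hBR x ((mem_iff_of_mem_words hu).1 hx) y ((mem_iff_of_mem_words hv).1 hy), hva⟩⟩
  · rintro ⟨⟨B, u⟩, v⟩ h ⟨⟨B', u'⟩, v'⟩ h' he
    simp only [Finset.mem_sigma, Finset.mem_filter, Finset.mem_powerset] at h h' he
    -- The first run is recovered from the word as its longest prefix of type `b`.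
    have hu := takeWhile_append_eq_left
      (fun x hx => h.1.1.2.2.1 x ((mem_iff_of_mem_words h.1.2).1 hx)) h.2.2.head
    rw [he, takeWhile_append_eq_left
      (fun x hx => h'.1.1.2.2.1 x ((mem_iff_of_mem_words h'.1.2).1 hx)) h'.2.2.head] at hu
    subst hu
    obtain rfl := List.append_cancel_left he
    obtain rfl : B = B' := by rw [← (mem_words.1 h.1.2).2, (mem_words.1 h'.1.2).2]
    rfl
  · intro w hw
    rw [Finset.mem_filter] at hw
    obtain ⟨hw, hwa⟩ := hw
    obtain ⟨u, v, rfl, hu, hub, hvt⟩ := hwa.exists_append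
      (mt (eq_nil_iff_of_mem_words hw).1 hU.ne_empty)
    have hwa := (admissible_append_iff hR hu hub hvt).1 hwa
    obtain ⟨hn, hwU⟩ := mem_words.1 hw
    rw [List.nodup_append'] at hn
    have hvU : U \ u.toFinset = v.toFinset := by
      rw [← hwU, List.toFinset_append, Finset.union_sdiff_left, Finset.sdiff_eq_self_iff_disjoint,
        List.disjoint_toFinset_iff_disjoint]
      exact hn.2.2.symm
    refine ⟨⟨⟨u.toFinset, u⟩, v⟩, ?_, rfl⟩
    simp only [Finset.mem_sigma, Finset.mem_filter, Finset.mem_powerset, hvU, mem_words,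
      List.mem_toFinset, List.toFinset_nonempty_iff]
    refine ⟨⟨⟨?_, hu, hub, hwa.1⟩, hn.1, trivial⟩, ⟨hn.2.1, trivial⟩, hwa.2⟩
    rw [← hwU, List.toFinset_append]
    exact Finset.subset_union_left
  · rintro ⟨⟨B, u⟩, v⟩ h
    simp only [Finset.mem_sigma, Finset.mem_filter, Finset.mem_powerset] at h ⊢
    obtain ⟨⟨⟨hB, hBn, hBb, hBR⟩, hu⟩, hv, hva⟩ := h
    have hun := mt (eq_nil_iff_of_mem_words hu).1 hBn.ne_empty
    rw [← wordDes_run_append hκ hun (fun x hx => hBb x ((mem_iff_of_mem_words hu).1 hx)) hva.head,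
      if_neg (by simp [hun])]

/-- Degree count for a first run `B`: if small, (|B| - 1) + (|U \ B| + 1) = |U|; if large, (|B| - 1)
+ 2 + |U \ B| = |U| + 1, the 2 coming from the factor `X`. -/
theorem runSum_mem_gammaCone (hinj : Function.Injective κ)
    (hκ : ∀ x y, large x = false → large y = true → κ x < κ y)
    (hR : ∀ x y, R x y → large x ≠ large y) (b : Bool) (U : Finset α) :
    runSum κ large R b U ∈ gammaCone (U.card + b.toNat) := by
  classical
  induction hN : U.card using Nat.strong_induction_on generalizing U b with
  | _ N ih =>
    rcases U.eq_empty_or_nonempty with rfl | hU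
    · rw [runSum, words_empty, Finset.sum_filter, Finset.sum_singleton]
      cases b
      · subst hN
        rw [if_pos ⟨List.Pairwise.nil, rfl, by simp⟩]
        simpa [wordDes] using one_mem_gammaCone
      · rw [if_neg fun h => by simpa [wordType] using h.head]
        exact zero_mem _
    · rw [runSum_eq_sum hκ hR b hU]
      refine sum_mem fun B hB => ?_
      simp only [Finset.mem_filter, Finset.mem_powerset] at hB
      obtain ⟨hB, hBn, -⟩ := hB
      have hc := Finset.card_sdiff_add_card_eq_card hB
      have hB0 := hBn.card_pos
      refine mul_mem_gammaCone (wordSum_mem_gammaCone hinj hBn)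
        (mul_mem_gammaCone (d := 2 * b.toNat) ?_ (ih (U \ B).card (by omega) (!b) (U \ B) rfl)
          rfl) ?_
      · simpa using basis_mem_gammaCone (j := b.toNat) (k := 0) rfl
      · cases b <;> simp <;> omega

end Words

/-! ### Linear extensions as words -/

section Bridge

variable {n : ℕ}

theorem card_descents_eq_wordDes {α : Type*} (κ : α → ℕ) (f : Fin n → α) :
    (Finset.univ.filter fun i : Fin n =>
      ∃ h : (i : ℕ) + 1 < n, κ (f ⟨(i : ℕ) + 1, h⟩) < κ (f i)).card =
      wordDes κ (List.ofFn f) := by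
  rw [Finset.card_filter]
  induction n with
  | zero => simp [wordDes]
  | succ n ih =>
    rw [Fin.sum_univ_succ, List.ofFn_succ]
    have h := ih fun i => f i.succ
    cases n with
    | zero =>
      rw [if_neg (by rintro ⟨h, -⟩; simp at h), Fin.sum_univ_zero]
      rfl
    | succ n =>
      rw [List.ofFn_succ, wordDes, ← List.ofFn_succ (f := fun i => f i.succ), ← h]
      congr 1
      · exact if_congr ⟨fun ⟨_, h⟩ => h, fun h => ⟨by simp, h⟩⟩ rfl rfl
      · refine Finset.sum_congr rfl fun i _ => if_congr ⟨fun ⟨h, h'⟩ => ⟨?_, h'⟩,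
          fun ⟨h, h'⟩ => ⟨?_, h'⟩⟩ rfl rfl <;> simpa using h

theorem exists_ofFn_eq {w : List (Fin n)} (hw : w ∈ words Finset.univ) :
    ∃ π : Equiv.Perm (Fin n), List.ofFn π = w := by
  have hlen : n = w.length := by
    rw [← List.toFinset_card_of_nodup (mem_words.1 hw).1, (mem_words.1 hw).2, Finset.card_fin]
  refine ⟨(finCongr hlen).trans (List.Nodup.getEquivOfForallMemList w (mem_words.1 hw).1
    fun x => (mem_iff_of_mem_words hw).2 (Finset.mem_univ x)), ?_⟩
  exact List.ext_getElem (by simpa using hlen) fun i h1 h2 => by simp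

theorem ofFn_mem_words (π : Equiv.Perm (Fin n)) : List.ofFn π ∈ words Finset.univ := by
  rw [mem_words]
  refine ⟨List.nodup_ofFn.2 π.injective, ?_⟩
  ext x
  simpa [List.mem_ofFn] using π.surjective x

theorem mem_linearExtensions_iff_pairwise {P : PartialOrder (Fin n)} {π : Equiv.Perm (Fin n)} :
    π ∈ linearExtensions P ↔ (List.ofFn π).Pairwise fun x y => ¬P.lt y x := by
  rw [mem_linearExtensions, List.pairwise_ofFn]
  constructor
  · intro h i j hij hlt
    have := h _ _ hlt
    rw [Equiv.symm_apply_apply, Equiv.symm_apply_apply] at this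
    rw [Fin.lt_def] at hij
    omega
  · intro h x y hxy
    by_contra hcon
    have hne : (π.symm x : ℕ) ≠ π.symm y := fun he => by
      have := π.symm.injective (Fin.ext he)
      subst this
      exact ((P.lt_iff_le_not_ge _ _).1 hxy).2 (P.le_refl _)
    refine h (i := π.symm y) (j := π.symm x) (Fin.lt_def.2 (by omega)) ?_
    simpa using hxy

theorem coeff_zero_labelSum (P : PartialOrder (Fin n)) (κ : Equiv.Perm (Fin n)) :
    (labelSum P κ).coeff 0 = 0 := by
  rw [labelSum, finsetSum_coeff]
  refine Finset.sum_eq_zero fun π _ => ?_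
  rw [coeff_X_pow, if_neg (by omega)]

/-- Listing the elements by increasing label gives the extension `κ⁻¹`, which has no descent. -/
theorem coeff_one_labelSum_pos {P : PartialOrder (Fin n)} {κ : Equiv.Perm (Fin n)}
    (hκ : IsNatural P κ) : 0 < (labelSum P κ).coeff 1 := by
  have hmem : κ⁻¹ ∈ linearExtensions P := mem_linearExtensions.2 hκ
  have hdes : des (κ * κ⁻¹) = 0 := by
    rw [mul_inv_cancel, des, descents, Finset.card_eq_zero, Finset.filter_eq_empty_iff]
    rintro i - ⟨h, hlt⟩
    rw [Fin.lt_def] at hlt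
    simp at hlt
  rw [labelSum, finsetSum_coeff]
  refine lt_of_lt_of_le ?_ (Finset.single_le_sum (fun π _ => ?_) hmem)
  · rw [hdes]; simp
  · rw [coeff_X_pow]
    split_ifs <;> simp

end Bridge

/-! ### The zig-zag poset -/

section ZigzagPoset

variable {n : ℕ}

/-- The labeling of the zig-zag poset in which all minimal elements precede all maximal elements. -/
noncomputable def bipartiteLabel (n : ℕ) : Equiv.Perm (Fin n) :=
  Equiv.ofBijective
    -- The number of minimal (even) elements is `(n + 1) / 2`.
    (fun v : Fin n => if h : (v : ℕ) % 2 = 0 then (⟨v / 2, by omega⟩ : Fin n)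
      else ⟨(n + 1) / 2 + v / 2, by omega⟩)
    (Finite.injective_iff_bijective.1 fun x y h => by
      rw [Fin.ext_iff]
      split_ifs at h <;> simp only [Fin.mk.injEq] at h <;> omega)

theorem bipartiteLabel_val (v : Fin n) : (bipartiteLabel n v : ℕ) =
    if (v : ℕ) % 2 = 0 then (v : ℕ) / 2 else (n + 1) / 2 + v / 2 := by
  simp only [bipartiteLabel, Equiv.ofBijective_apply]
  split_ifs <;> rfl

theorem bipartiteLabel_lt {x y : Fin n} (hx : (x : ℕ) % 2 = 0) (hy : (y : ℕ) % 2 = 1) :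
    (bipartiteLabel n x : ℕ) < bipartiteLabel n y := by
  rw [bipartiteLabel_val, bipartiteLabel_val, if_pos hx, if_neg (by omega)]
  omega

theorem zigzag_lt_iff {x y : Fin n} : (zigzag n).lt x y ↔
    (x : ℕ) % 2 = 0 ∧ (y : ℕ) % 2 = 1 ∧ ((y : ℕ) = x + 1 ∨ (x : ℕ) = y + 1) := by
  rw [← Nat.even_iff, ← Nat.odd_iff]
  rfl

theorem isNatural_bipartiteLabel : IsNatural (zigzag n) (bipartiteLabel n) := fun _ _ h =>
  bipartiteLabel_lt (zigzag_lt_iff.1 h).1 (zigzag_lt_iff.1 h).2.1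

theorem isNatural_eps : IsNatural (zigzag n) (eps n) := by
  intro x y h
  rw [zigzag_lt_iff] at h
  change (epsFun n x : ℕ) < epsFun n y
  simp only [epsFun, Nat.odd_iff]
  split_ifs <;> (try simp only) <;> omega

/-- For `2 ≤ n` every element has a neighbour: a maximal element has one below it and cannot come
first, a minimal element has one above it and cannot come last. -/
theorem admissible_of_pairwise (hn : 2 ≤ n) {w : List (Fin n)} (hw : w ∈ words Finset.univ)
    (h : w.Pairwise fun x y => ¬(zigzag n).lt y x) :
    Admissible (fun v : Fin n => decide ((v : ℕ) % 2 = 1)) (zigzag n).lt false w := by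
  have hmem : ∀ x, x ∈ w := fun x => (mem_iff_of_mem_words hw).2 (Finset.mem_univ x)
  refine ⟨h, ?_, fun a ha => ?_⟩
  · cases w with
    | nil => rfl
    | cons a w =>
      change decide ((a : ℕ) % 2 = 1) = false
      rw [decide_eq_false_iff_not]
      intro ha
      have hc := hmem ⟨a - 1, by omega⟩
      rw [List.mem_cons, Fin.ext_iff] at hc
      refine (List.pairwise_cons.1 h).1 _ (hc.resolve_left ?_) (zigzag_lt_iff.2 ?_) <;>
        simp only <;> omega
  · rw [decide_eq_true_iff]
    by_contra hcon
    obtain ⟨u, rfl⟩ := List.getLast?_eq_some_iff.1 ha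
    obtain ⟨c, hc⟩ : ∃ c, (zigzag n).lt a c := by
      by_cases hlt : (a : ℕ) + 1 < n
      · exact ⟨⟨a + 1, hlt⟩, zigzag_lt_iff.2 ⟨by omega, by simp only; omega, Or.inl rfl⟩⟩
      · exact ⟨⟨a - 1, by omega⟩, zigzag_lt_iff.2 (by simp only; omega)⟩
    have hcu : c ∈ u := by
      have := hmem c
      rw [List.mem_append, List.mem_singleton] at this
      refine this.resolve_right fun he => ?_
      rw [he, zigzag_lt_iff] at hc
      omega
    exact (List.pairwise_append.1 h).2.2 c hcu a (by simp) hc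

/-- The 1 in the exponent `1 + des` is the descent counted at the end of a nonempty word. -/
theorem labelSum_zigzag_eq_runSum (hn : 2 ≤ n) (κ : Equiv.Perm (Fin n)) :
    labelSum (zigzag n) κ = runSum (fun v => (κ v : ℕ))
      (fun v : Fin n => decide ((v : ℕ) % 2 = 1)) (zigzag n).lt false Finset.univ := by
  classical
  rw [labelSum, runSum]
  refine Finset.sum_bij (fun π _ => List.ofFn π) ?_ ?_ ?_ ?_
  · intro π hπ
    rw [Finset.mem_filter]
    exact ⟨ofFn_mem_words π, admissible_of_pairwise hn (ofFn_mem_words π)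
      (mem_linearExtensions_iff_pairwise.1 hπ)⟩
  · intro π _ π' _ h
    exact DFunLike.coe_injective (List.ofFn_injective h)
  · intro w hw
    rw [Finset.mem_filter] at hw
    obtain ⟨π, rfl⟩ := exists_ofFn_eq hw.1
    exact ⟨π, mem_linearExtensions_iff_pairwise.2 hw.2.pairwise, rfl⟩
  · intro π _
    have hne : List.ofFn π ≠ [] := fun h => by
      rw [List.ofFn_eq_nil_iff] at h
      omega
    rw [if_neg hne, ← card_descents_eq_wordDes, add_comm]
    rfl

theorem zigzagEulerian_eq_labelSum : zigzagEulerian n = labelSum (zigzag n) (eps n) :=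
  eulerianPoly_relabel _ _

theorem zigzagEulerian_mem_gammaCone (hn : 2 ≤ n) : zigzagEulerian n ∈ gammaCone n := by
  rw [zigzagEulerian_eq_labelSum, labelSum_eq_of_isNatural _ isNatural_eps isNatural_bipartiteLabel,
    labelSum_zigzag_eq_runSum hn]
  have := runSum_mem_gammaCone (κ := fun v => (bipartiteLabel n v : ℕ))
    (large := fun v : Fin n => decide ((v : ℕ) % 2 = 1)) (R := (zigzag n).lt)
    (fun x y h => (bipartiteLabel n).injective (Fin.ext h))
    (fun x y hx hy => bipartiteLabel_lt (by simpa using hx) (by simpa using hy))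
    (fun x y h => by
      have := zigzag_lt_iff.1 h
      rw [ne_eq, decide_eq_decide]
      omega) false Finset.univ
  simpa using this

theorem exists_zigzagEulerian_expansion (hn : 2 ≤ n) : ∃ γ : ℕ → ℕ,
    zigzagEulerian n = ∑ j ∈ Finset.range ((n - 2) / 2 + 1),
      (γ j : ℤ[X]) * (X ^ (j + 1) * (1 + X) ^ (n - 2 * (j + 1))) := by
  obtain ⟨γ, hγ⟩ := exists_gamma_vector (zigzagEulerian_mem_gammaCone hn)
  rw [Finset.sum_range_succ', show n / 2 = (n - 2) / 2 + 1 by omega] at hγ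
  -- At 0 only the basis polynomial with j = 0 survives, with value 1.
  have h0 : (γ 0 : ℤ) = 0 := by
    have h := congrArg (eval 0) hγ
    rw [← coeff_zero_eq_eval_zero, zigzagEulerian_eq_labelSum, coeff_zero_labelSum] at h
    simpa [eval_finsetSum] using h.symm
  refine ⟨fun j => γ (j + 1), ?_⟩
  rw [hγ, Nat.cast_eq_zero.1 h0]
  simp

end ZigzagPoset

/-! ### Consequences of a gamma expansion -/

section Consequences

theorem coeff_gamma_basis (m j k : ℕ) : (X ^ j * (1 + X) ^ (m - 2 * j) : ℤ[X]).coeff k =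
    if j ≤ k then ((m - 2 * j).choose (k - j) : ℤ) else 0 := by
  rw [coeff_X_pow_mul', coeff_one_add_X_pow]

theorem coeff_gamma_basis_symm {m j k : ℕ} (hj : j ≤ m / 2) (hk : k ≤ m) :
    (X ^ j * (1 + X) ^ (m - 2 * j) : ℤ[X]).coeff k =
      (X ^ j * (1 + X) ^ (m - 2 * j) : ℤ[X]).coeff (m - k) := by
  rw [coeff_gamma_basis, coeff_gamma_basis]
  split_ifs with h1 h2 h2
  · exact congrArg _ (Nat.choose_symm_of_eq_add (by omega))
  -- Here `m - k < j`, so `k - j` exceeds `m - 2 * j`.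
  · rw [Nat.choose_eq_zero_of_lt (by omega)]
    rfl
  · rw [Nat.choose_eq_zero_of_lt (by omega)]
    rfl
  · rfl

/-- The basis polynomials are binomial rows shifted to the common center m/2, so all of them
increase up to it. -/
theorem coeff_gamma_basis_le_succ {m j k : ℕ} (hk : k + 1 ≤ m / 2) :
    (X ^ j * (1 + X) ^ (m - 2 * j) : ℤ[X]).coeff k ≤
      (X ^ j * (1 + X) ^ (m - 2 * j) : ℤ[X]).coeff (k + 1) := by
  rw [coeff_gamma_basis, coeff_gamma_basis]
  split_ifs with h1 h2 h2
  · rw [show k + 1 - j = k - j + 1 by omega]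
    exact_mod_cast Nat.choose_le_succ_of_lt_half_left (by omega)
  · omega
  · positivity
  · rfl

theorem T_mul_invert_gamma_basis {n j : ℕ} (hj : 2 * j ≤ n) :
    LaurentPolynomial.T (n : ℤ) * LaurentPolynomial.invert
      (toLaurent (X ^ j * (1 + X) ^ (n - 2 * j) : ℤ[X])) =
      toLaurent (X ^ j * (1 + X) ^ (n - 2 * j) : ℤ[X]) := by
  obtain ⟨k, rfl⟩ := Nat.exists_eq_add_of_le hj
  have h1 : (LaurentPolynomial.T 1 : LaurentPolynomial ℤ) * LaurentPolynomial.T (-1) = 1 := by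
    rw [← LaurentPolynomial.T_add]; simp
  have h2 : (LaurentPolynomial.T ((2 * j + k : ℕ) : ℤ) : LaurentPolynomial ℤ) =
      LaurentPolynomial.T 1 ^ (2 * j + k) := by
    rw [LaurentPolynomial.T_pow]; simp
  rw [h2, show 2 * j + k - 2 * j = k by omega]
  simp only [map_mul, map_pow, map_add, map_one, toLaurent_X, LaurentPolynomial.invert_T]
  -- Give two factors t to each t⁻¹ and one to each 1 + t⁻¹.
  have h3 : (LaurentPolynomial.T 1 : LaurentPolynomial ℤ) ^ (2 * j + k) *
      (LaurentPolynomial.T (-1) ^ j * (1 + LaurentPolynomial.T (-1)) ^ k) =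
      LaurentPolynomial.T 1 ^ j * (LaurentPolynomial.T 1 * LaurentPolynomial.T (-1)) ^ j *
        (LaurentPolynomial.T 1 + LaurentPolynomial.T 1 * LaurentPolynomial.T (-1)) ^ k := by
    rw [show (LaurentPolynomial.T 1 + LaurentPolynomial.T 1 * LaurentPolynomial.T (-1) :
      LaurentPolynomial ℤ) = LaurentPolynomial.T 1 * (1 + LaurentPolynomial.T (-1)) by ring,
      mul_pow, mul_pow]
    ring
  rw [h3, h1, one_pow, mul_one, add_comm (LaurentPolynomial.T 1)]

variable {n : ℕ} {γ : ℕ → ℕ} (hn : 2 ≤ n)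
  (hγ : zigzagEulerian n = ∑ j ∈ Finset.range ((n - 2) / 2 + 1),
    (γ j : ℤ[X]) * (X ^ (j + 1) * (1 + X) ^ (n - 2 * (j + 1))))

include hγ

theorem zigzagEulerian_eq_X_mul : zigzagEulerian n = X * ∑ j ∈ Finset.range ((n - 2) / 2 + 1),
    (γ j : ℤ[X]) * (X ^ j * (1 + X) ^ (n - 2 - 2 * j)) := by
  rw [hγ, Finset.mul_sum]
  refine Finset.sum_congr rfl fun j _ => ?_
  rw [show n - 2 * (j + 1) = n - 2 - 2 * j by omega]
  ring

theorem zigzagNumber_eq_sum (k : ℕ) : zigzagNumber n k = ∑ j ∈ Finset.range ((n - 2) / 2 + 1),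
    (γ j : ℤ) * (X ^ j * (1 + X) ^ (n - 2 - 2 * j) : ℤ[X]).coeff k := by
  rw [zigzagNumber, zigzagEulerian_eq_X_mul hγ, coeff_X_mul, finsetSum_coeff]
  refine Finset.sum_congr rfl fun j _ => ?_
  rw [← Int.cast_natCast (R := ℤ[X]), ← C_eq_intCast, coeff_C_mul]
  rfl

theorem zigzagNumber_symm {k : ℕ} (hk : k ≤ n - 2) :
    zigzagNumber n k = zigzagNumber n (n - 2 - k) := by
  rw [zigzagNumber_eq_sum hγ, zigzagNumber_eq_sum hγ]
  refine Finset.sum_congr rfl fun j hj => ?_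
  rw [coeff_gamma_basis_symm (Nat.lt_succ_iff.1 (Finset.mem_range.1 hj)) hk]

theorem zigzagNumber_le_succ {k : ℕ} (hk : k + 1 ≤ (n - 2) / 2) :
    zigzagNumber n k ≤ zigzagNumber n (k + 1) := by
  rw [zigzagNumber_eq_sum hγ, zigzagNumber_eq_sum hγ]
  exact Finset.sum_le_sum fun j _ =>
    mul_le_mul_of_nonneg_left (coeff_gamma_basis_le_succ hk) (Nat.cast_nonneg _)

theorem zigzagNumber_succ_le {k : ℕ} (hk : (n - 2) / 2 ≤ k) (hk' : k + 1 ≤ n - 2) :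
    zigzagNumber n (k + 1) ≤ zigzagNumber n k := by
  -- The first case is the step between the two central coefficients for odd `n`, which are equal;
  -- otherwise reflect into the increasing half.
  rcases Nat.lt_or_ge ((n - 2) / 2) (n - 2 - k) with h | h
  · rw [zigzagNumber_symm hγ (k := k + 1) hk', show n - 2 - (k + 1) = k by omega]
  · rw [zigzagNumber_symm hγ (k := k + 1) hk', zigzagNumber_symm hγ (k := k) (by omega),
      show n - 2 - k = n - 2 - (k + 1) + 1 by omega]
    exact zigzagNumber_le_succ hγ (by omega)

include hn

theorem isPalindromicOfDegree_zigzagEulerian : IsPalindromicOfDegree (zigzagEulerian n) n := by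
  refine ⟨by omega, ?_⟩
  rw [hγ]
  simp only [map_sum, Finset.mul_sum]
  refine Finset.sum_congr rfl fun j hj => ?_
  have hj := Finset.mem_range.1 hj
  have h := T_mul_invert_gamma_basis (n := n) (j := j + 1) (by omega)
  rw [map_mul toLaurent, map_mul LaurentPolynomial.invert, mul_left_comm, h]
  simp

theorem degree_zigzagEulerian : (zigzagEulerian n).degree = ((n - 1 : ℕ) : WithBot ℕ) := by
  refine degree_eq_of_le_of_coeff_ne_zero ?_ ?_
  · rw [hγ]
    refine degree_le_of_natDegree_le (natDegree_sum_le_of_forall_le _ _ fun j hj => ?_)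
    have hj := Finset.mem_range.1 hj
    compute_degree
    omega
  -- By symmetry the coefficient of t^(n-1) is that of t, which is positive.
  · have h : zigzagNumber n 0 = zigzagNumber n (n - 2) := zigzagNumber_symm hγ (Nat.zero_le _)
    rw [zigzagNumber, zigzagNumber, show n - 2 + 1 = n - 1 by omega] at h
    rw [← h, zigzagEulerian_eq_labelSum]
    exact (coeff_one_labelSum_pos isNatural_eps).ne'

end Consequences

end ZigZag

theorem theorem2p2 (n : ℕ) (hn : 2 ≤ n) :
    (∃ γ : ℕ → ℕ,
      ZigZag.zigzagEulerian n =
        X * ∑ j ∈ Finset.range ((n - 2) / 2 + 1),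
          (γ j : ℤ[X]) * (X ^ j * (1 + X) ^ (n - 2 - 2 * j)) ∧
      ZigZag.zigzagEulerian n =
        ∑ j ∈ Finset.range ((n - 2) / 2 + 1),
          (γ j : ℤ[X]) * (X ^ (j + 1) * (1 + X) ^ (n - 2 * (j + 1)))) ∧
    (ZigZag.zigzagEulerian n).degree = ((n - 1 : ℕ) : WithBot ℕ) ∧
    ZigZag.IsPalindromicOfDegree (ZigZag.zigzagEulerian n) n ∧
    (∀ k : ℕ, k ≤ n - 2 → ZigZag.zigzagNumber n k = ZigZag.zigzagNumber n (n - 2 - k)) ∧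
    (∀ k : ℕ, k + 1 ≤ (n - 2) / 2 → ZigZag.zigzagNumber n k ≤ ZigZag.zigzagNumber n (k + 1)) ∧
    (∀ k : ℕ, (n - 2) / 2 ≤ k → k + 1 ≤ n - 2 →
      ZigZag.zigzagNumber n (k + 1) ≤ ZigZag.zigzagNumber n k) := by
  obtain ⟨γ, hγ⟩ := ZigZag.exists_zigzagEulerian_expansion hn
  exact ⟨⟨γ, ZigZag.zigzagEulerian_eq_X_mul hγ, hγ⟩, ZigZag.degree_zigzagEulerian hn hγ,
    ZigZag.isPalindromicOfDegree_zigzagEulerian hn hγ, fun k hk => ZigZag.zigzagNumber_symm hγ hk,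
    fun k hk => ZigZag.zigzagNumber_le_succ hγ hk,
    fun k hk hk' => ZigZag.zigzagNumber_succ_le hγ hk hk'⟩
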